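/- Let $D$ be a Prüfer domain with quotient field $K$ (that is, $D_P$ is a valuation domain for every prime $P$ of $D$), and let $X\subseteq\operatorname{Max}(D)$ be a splitting set, i.e. a set of prime ideals closed under specialization such that $\operatorname{Spec}(D)\setminus X$ is compact in the Zariski topology. For a fractional ideal $I$ of $D$ put $\operatorname{supp}(I)=\{P\in\operatorname{Spec}(D): ID_P\neq D_P\}$, $(D:I)=\{x\in K: xI\subseteq D\}$ and $I^v=(D:(D:I))$. Let $\operatorname{Inv}(D)$ be the group of invertible fractional ideals under the ordinary product, and let $\operatorname{Div}(D)$ be the group, under the $v$-product $I\times_v J=(IJ)^v$, of the divisorial ($I=I^v$) fractional ideals $I$ that are $v$-invertible ($(IJ)^v=D$ for some fractional ideal $J$). Both are ordered by reverse containment. Put $$\operatorname{Inv}_X(D)=\{I\in\operatorname{Inv}(D):\operatorname{supp}(I)\subseteq X\},\qquad \operatorname{Div}_X(D)=\{I\in\operatorname{Div}(D):\operatorname{supp}(I)\subseteq X,\ \operatorname{supp}(D:I)\subseteq X\}.$$ Then $\operatorname{Div}(D)$ is an $\ell$-group (a lattice-ordered group), and $\operatorname{Div}_X(D)$ is a convex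 subgroup of it: if $a\le b\le c$ with $a,c\in\operatorname{Div}_X(D)$ and $b\in\operatorname{Div}(D)$, then $b\in\operatorname{Div}_X(D)$. With the induced order $\operatorname{Div}_X(D)$ is a complete $\ell$-group: every nonempty subset that is bounded above has a supremum. Moreover, $\operatorname{Div}_X(D)$ is the completion of the $\ell$-group $\operatorname{Inv}_X(D)$ via the inclusion $\operatorname{Inv}_X(D)\subseteq\operatorname{Div}_X(D)$. This means the following. 1. The inclusion is a group homomorphism and an order embedding that preserves binary suprema and infima. 2. $\operatorname{Inv}_X(D)$ is dense in $\operatorname{Div}_X(D)$: for every $x\in\operatorname{Div}_X(D)$ with $x>1$ there are $g,g'\in\operatorname{Inv}_X(D)$ with $1<g\le x\le g'$. 3. Every $x\in\operatorname{Div}_X(D)$ is the supremum of the elements of $\operatorname{Inv}_X(D)$ below it and the infimum of those above it. 4. Let $H$ be a complete $\ell$-group. Call a group homomorphism to $H$ order-continuous if it preserves all existing suprema of nonempty sets. Every order-continuous homomorphism $\operatorname{Inv}_X(D)\to H$ extends uniquely to an order-continuous homomorphism $\operatorname{Div}_X(D)\to H$. (Complete $\ell$-groups are abelian, so $H$ is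 taken abelian.) -/

import Mathlib

open scoped nonZeroDivisors

set_option linter.unusedSectionVars false

universe u v w

noncomputable section

namespace PruferDiv

/-! ### Lattice-ordered groups -/

/-- An (abelian) `ℓ`-group: a translation-invariant order in which any two elements have a
supremum and an infimum. -/
structure IsLGroup (G : Type*) [CommGroup G] [PartialOrder G] : Prop where
  isOrderedMonoid : IsOrderedMonoid G
  exists_sup : ∀ a b : G, ∃ c, IsLUB {a, b} c
  exists_inf : ∀ a b : G, ∃ c, IsGLB {a, b} c

/-- A complete `ℓ`-group: every nonempty subset that is bounded above has a supremum. -/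
structure IsCompleteLGroup (G : Type*) [CommGroup G] [PartialOrder G] : Prop where
  isLGroup : IsLGroup G
  exists_isLUB : ∀ S : Set G, S.Nonempty → BddAbove S → ∃ c, IsLUB S c

/-- A group homomorphism is order-continuous if it preserves all existing nonempty suprema. (Being
a group homomorphism, it then preserves nonempty infima as well, and it is an `ℓ`-homomorphism.) -/
def OrderContinuousHom {G H : Type*} [CommGroup G] [PartialOrder G] [CommGroup H] [PartialOrder H]
    (f : G →* H) : Prop :=
  ∀ (S : Set G) (a : G), S.Nonempty → IsLUB S a → IsLUB (f '' S) (f a)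

/-- `i : G → C` exhibits the complete `ℓ`-group `C` as the completion of the `ℓ`-group `G`. -/
structure IsLCompletion {G : Type u} {C : Type v} [CommGroup G] [PartialOrder G]
    [CommGroup C] [PartialOrder C] (i : G →* C) : Prop where
  isLGroup : IsLGroup G
  isCompleteLGroup : IsCompleteLGroup C
  /-- `i` identifies `G` with an `ℓ`-subgroup of `C` -/
  le_iff_le : ∀ a b : G, i a ≤ i b ↔ a ≤ b
  map_sup : ∀ a b c : G, IsLUB {a, b} c → IsLUB {i a, i b} (i c)
  map_inf : ∀ a b c : G, IsGLB {a, b} c → IsGLB {i a, i b} (i c)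
  /-- `G` is dense in `C` -/
  dense : ∀ x : C, 1 < x → ∃ g g' : G, 1 < i g ∧ i g ≤ x ∧ x ≤ i g'
  /-- every element of `C` is the join of the elements of `G` below it, and the meet of those
  above it -/
  isLUB_below : ∀ x : C, IsLUB {y | y ∈ Set.range i ∧ y ≤ x} x
  isGLB_above : ∀ x : C, IsGLB {y | y ∈ Set.range i ∧ x ≤ y} x
  /-- minimality: order-continuous maps to complete `ℓ`-groups factor uniquely through `C` -/
  lift : ∀ (H : Type w) [CommGroup H] [PartialOrder H], IsCompleteLGroup H →
    ∀ f : G →* H, OrderContinuousHom f →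
      ∃! F : C →* H, OrderContinuousHom F ∧ F.comp i = f

/-! ### Prüfer domains, supports, splitting sets -/

section Ideals

variable (D : Type u) [CommRing D] [IsDomain D]

/-- A Prüfer domain: the localization at every prime ideal is a valuation domain. -/
def IsPruferDomain : Prop :=
  ∀ (P : Ideal D) [P.IsPrime], ValuationRing (Localization.AtPrime P)

variable {D}

/-- A splitting set: a set of primes closed under specialization whose complement is compact in
the Zariski topology. -/
def IsSplittingSet (X : Set (PrimeSpectrum D)) : Prop :=
  IsUpperSet X ∧ IsCompact Xᶜ

variable (K : Type v) [Field K] [Algebra D K] [IsFractionRing D K]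

/-- The localization `D_P`, as a `D`-submodule of the quotient field `K`. -/
def locAt (P : PrimeSpectrum D) : Submodule D K :=
  Subalgebra.toSubmodule
    (Localization.subalgebra.ofField K P.asIdeal.primeCompl P.asIdeal.primeCompl_le_nonZeroDivisors)

variable {K}

/-- The support `{P | I D_P ≠ D_P}` of a fractional ideal `I`. -/
def supp (I : FractionalIdeal D⁰ K) : Set (PrimeSpectrum D) :=
  {P | (I : Submodule D K) * locAt K P ≠ locAt K P}

/-! ### Invertible ideals -/

variable (D K)

/-- `Inv(D)`: the group of invertible fractional ideals, ordered by reverse containment. -/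
abbrev InvGroup : Type v := ((FractionalIdeal D⁰ K)ˣ)ᵒᵈ

variable {D K}

/-- The fractional ideal underlying an element of `Inv(D)`. -/
def InvGroup.ideal (I : InvGroup D K) : FractionalIdeal D⁰ K :=
  ((OrderDual.ofDual I : (FractionalIdeal D⁰ K)ˣ) : FractionalIdeal D⁰ K)

theorem InvGroup.ideal_one : InvGroup.ideal (1 : InvGroup D K) = 1 := rfl

theorem InvGroup.ideal_mul (I J : InvGroup D K) :
    InvGroup.ideal (I * J) = InvGroup.ideal I * InvGroup.ideal J := rfl

theorem InvGroup.le_iff (I J : InvGroup D K) :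
    I ≤ J ↔ InvGroup.ideal J ≤ InvGroup.ideal I := Iff.rfl

variable (K)

/-- `Inv_X(D)`: the invertible ideals with support contained in `X`. -/
def invX (X : Set (PrimeSpectrum D)) : Subgroup (InvGroup D K) where
  carrier := {I | supp (InvGroup.ideal I) ⊆ X}
  one_mem' := by
    intro P hP
    exact absurd (by simp [InvGroup.ideal_one]) hP
  mul_mem' := by
    intro I J hI hJ P hP
    by_contra hPX
    have h1 := not_not.mp (fun h => hPX (hI h))
    have h2 := not_not.mp (fun h => hPX (hJ h))
    exact hP (by rw [InvGroup.ideal_mul, FractionalIdeal.coe_mul, mul_assoc, h2, h1])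
  inv_mem' := by
    intro I hI P hP
    by_contra hPX
    have h1 := not_not.mp (fun h => hPX (hI h))
    refine hP ?_
    have h3 : InvGroup.ideal I⁻¹ * InvGroup.ideal I = 1 := by
      rw [← InvGroup.ideal_mul, inv_mul_cancel, InvGroup.ideal_one]
    calc ((InvGroup.ideal I⁻¹ : FractionalIdeal D⁰ K) : Submodule D K) * locAt K P
        = (InvGroup.ideal I⁻¹ : Submodule D K) * ((InvGroup.ideal I : Submodule D K) * locAt K P) := by
          rw [h1]
      _ = locAt K P := by
          rw [← mul_assoc, ← FractionalIdeal.coe_mul, h3]; simp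

variable {K}

/-! ### Divisorial ideals -/

/-- The `v`-closure `(D : (D : I))`. In Mathlib `I⁻¹` is the conductor `(D : I)` for `I ≠ 0`,
and `0⁻¹ = 0`. -/
def vClosure (I : FractionalIdeal D⁰ K) : FractionalIdeal D⁰ K := (I⁻¹)⁻¹

/-- `I` is `v`-invertible if `(I J)^v = D` for some fractional ideal `J`. -/
def IsVInvertible (I : FractionalIdeal D⁰ K) : Prop :=
  ∃ J : FractionalIdeal D⁰ K, vClosure (I * J) = 1

theorem mul_inv_le_one (I : FractionalIdeal D⁰ K) : I * I⁻¹ ≤ 1 := by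
  by_cases hI : I = 0
  · simp [hI]
  · rw [mul_comm]
    exact (FractionalIdeal.le_div_iff_mul_le hI).mp (le_of_eq (FractionalIdeal.inv_eq K))

theorem le_inv_of_mul_le_one {I J : FractionalIdeal D⁰ K} (hI : I ≠ 0) (h : J * I ≤ 1) :
    J ≤ I⁻¹ := by
  rw [FractionalIdeal.inv_eq]
  exact (FractionalIdeal.le_div_iff_mul_le hI).mpr h

theorem inv_anti {I J : FractionalIdeal D⁰ K} (hI : I ≠ 0) (h : I ≤ J) : J⁻¹ ≤ I⁻¹ := by
  refine le_inv_of_mul_le_one hI ?_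
  calc J⁻¹ * I ≤ J⁻¹ * J := by gcongr
    _ ≤ 1 := by rw [mul_comm]; exact mul_inv_le_one J

theorem vClosure_zero : vClosure (0 : FractionalIdeal D⁰ K) = 0 := by
  simp only [vClosure, FractionalIdeal.inv_zero']

theorem vClosure_one : vClosure (1 : FractionalIdeal D⁰ K) = 1 := by
  simp [vClosure]

theorem inv_ne_zero_of_ne_zero {I : FractionalIdeal D⁰ K} (hI : I ≠ 0) : I⁻¹ ≠ 0 := by
  obtain ⟨a, J, ha, h⟩ := FractionalIdeal.exists_eq_spanSingleton_mul I
  have ha' : algebraMap D K a ≠ 0 := by simpa using ha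
  intro h0
  have h1 : FractionalIdeal.spanSingleton D⁰ (algebraMap D K a) ≤ I⁻¹ := by
    refine le_inv_of_mul_le_one hI ?_
    rw [h, ← mul_assoc, FractionalIdeal.spanSingleton_mul_spanSingleton, mul_inv_cancel₀ ha',
      FractionalIdeal.spanSingleton_one, one_mul]
    exact FractionalIdeal.coeIdeal_le_one
  rw [h0, FractionalIdeal.spanSingleton_le_iff_mem, FractionalIdeal.mem_zero_iff] at h1
  exact ha' h1

theorem le_vClosure (I : FractionalIdeal D⁰ K) : I ≤ vClosure I := by
  by_cases hI : I = 0
  · simp [hI]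
  · exact le_inv_of_mul_le_one (inv_ne_zero_of_ne_zero hI) (mul_inv_le_one I)

theorem inv_vClosure (I : FractionalIdeal D⁰ K) : (vClosure I)⁻¹ = I⁻¹ := by
  by_cases hI : I = 0
  · simp only [hI, vClosure_zero]
  · exact le_antisymm (inv_anti hI (le_vClosure I)) (le_vClosure I⁻¹)

theorem vClosure_vClosure (I : FractionalIdeal D⁰ K) : vClosure (vClosure I) = vClosure I :=
  congrArg (·⁻¹) (inv_vClosure I)

theorem vClosure_mono {I J : FractionalIdeal D⁰ K} (h : I ≤ J) : vClosure I ≤ vClosure J := by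
  by_cases hI : I = 0
  · simp [hI, vClosure_zero]
  · have hJ : J ≠ 0 := fun h0 => hI (by simpa [h0] using h)
    exact inv_anti (inv_ne_zero_of_ne_zero hJ) (inv_anti hI h)

theorem ideal_mul_ne_zero {I J : FractionalIdeal D⁰ K} (hI : I ≠ 0) (hJ : J ≠ 0) :
    I * J ≠ 0 := by
  intro h
  have h1 : (I : Submodule D K) * (J : Submodule D K) = ⊥ := by
    rw [← FractionalIdeal.coe_mul, h, FractionalIdeal.coe_zero]
  rcases Submodule.mul_eq_bot.mp h1 with h2 | h2
  · exact hI (FractionalIdeal.coeToSubmodule_eq_bot.mp h2)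
  · exact hJ (FractionalIdeal.coeToSubmodule_eq_bot.mp h2)

theorem vClosure_vClosure_mul (I J : FractionalIdeal D⁰ K) :
    vClosure (vClosure I * J) = vClosure (I * J) := by
  by_cases hI : I = 0
  · simp [hI, vClosure_zero]
  by_cases hJ : J = 0
  · simp [hJ]
  have hv : vClosure I ≠ 0 := inv_ne_zero_of_ne_zero (inv_ne_zero_of_ne_zero hI)
  have key : (vClosure I * J)⁻¹ = (I * J)⁻¹ := by
    refine le_antisymm (inv_anti (ideal_mul_ne_zero hI hJ) ?_) ?_
    · gcongr
      exact le_vClosure I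
    · refine le_inv_of_mul_le_one (ideal_mul_ne_zero hv hJ) ?_
      have h1 : (I * J)⁻¹ * J ≤ I⁻¹ := by
        refine le_inv_of_mul_le_one hI ?_
        calc (I * J)⁻¹ * J * I = (I * J) * (I * J)⁻¹ := by ring
          _ ≤ 1 := mul_inv_le_one _
      calc (I * J)⁻¹ * (vClosure I * J) = (I * J)⁻¹ * J * vClosure I := by ring
        _ ≤ I⁻¹ * vClosure I := by gcongr
        _ ≤ 1 := mul_inv_le_one I⁻¹
  exact congrArg (·⁻¹) key

theorem vClosure_mul_vClosure (I J : FractionalIdeal D⁰ K) :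
    vClosure (I * vClosure J) = vClosure (I * J) := by
  rw [mul_comm, vClosure_vClosure_mul, mul_comm]

theorem vClosure_mul_inv {I : FractionalIdeal D⁰ K} (hI : IsVInvertible I) :
    vClosure (I * I⁻¹) = 1 := by
  obtain ⟨J, hJ⟩ := hI
  have h0 : I ≠ 0 := by
    rintro rfl
    rw [zero_mul, vClosure_zero] at hJ
    exact zero_ne_one hJ
  have h1 : I * J ≤ 1 := hJ ▸ le_vClosure (I * J)
  have h2 : J ≤ I⁻¹ := le_inv_of_mul_le_one h0 (by rwa [mul_comm])
  refine le_antisymm ?_ ?_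
  · calc vClosure (I * I⁻¹) ≤ vClosure 1 := vClosure_mono (mul_inv_le_one I)
      _ = 1 := vClosure_one
  · rw [← hJ]
    exact vClosure_mono (by gcongr)

variable (D K)

/-- `Div(D)`: the `v`-invertible divisorial fractional ideals. -/
@[ext]
structure DivGroup : Type v where
  ideal : FractionalIdeal D⁰ K
  divisorial : ideal = vClosure ideal
  vInvertible : IsVInvertible ideal

variable {D K}

namespace DivGroup

/-- The group structure given by the `v`-product `(I J)^v`; the inverse of `I` is `(D : I)`. -/
instance : CommGroup (DivGroup D K) where
  mul I J :=
    ⟨vClosure (I.ideal * J.ideal), (vClosure_vClosure _).symm,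
      I.ideal⁻¹ * J.ideal⁻¹, by
        rw [vClosure_vClosure_mul, mul_mul_mul_comm, ← vClosure_vClosure_mul,
          vClosure_mul_inv I.vInvertible, one_mul, vClosure_mul_inv J.vInvertible]⟩
  one := ⟨1, vClosure_one.symm, 1, by rw [one_mul, vClosure_one]⟩
  inv I := ⟨I.ideal⁻¹, (inv_vClosure I.ideal).symm, I.ideal, by
    rw [mul_comm, vClosure_mul_inv I.vInvertible]⟩
  mul_assoc I J L := DivGroup.ext (by
    change vClosure (vClosure (I.ideal * J.ideal) * L.ideal) =
      vClosure (I.ideal * vClosure (J.ideal * L.ideal))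
    rw [vClosure_vClosure_mul, vClosure_mul_vClosure, mul_assoc])
  one_mul I := DivGroup.ext (by
    change vClosure (1 * I.ideal) = I.ideal
    rw [one_mul, ← I.divisorial])
  mul_one I := DivGroup.ext (by
    change vClosure (I.ideal * 1) = I.ideal
    rw [mul_one, ← I.divisorial])
  inv_mul_cancel I := DivGroup.ext (by
    change vClosure (I.ideal⁻¹ * I.ideal) = 1
    rw [mul_comm, vClosure_mul_inv I.vInvertible])
  mul_comm I J := DivGroup.ext (by
    change vClosure (I.ideal * J.ideal) = vClosure (J.ideal * I.ideal)
    rw [mul_comm])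

/-- `Div(D)` is ordered by reverse containment. -/
instance : PartialOrder (DivGroup D K) :=
  PartialOrder.lift (fun I => OrderDual.toDual I.ideal) fun _ _ h => DivGroup.ext h

theorem le_iff (I J : DivGroup D K) : I ≤ J ↔ J.ideal ≤ I.ideal := Iff.rfl

end DivGroup

variable (K)

/-- `Div_X(D)`: those `I ∈ Div(D)` such that the supports of `I` and of `(D : I)` lie in `X`. -/
def divX (X : Set (PrimeSpectrum D)) : Set (DivGroup D K) :=
  {I | supp I.ideal ⊆ X ∧ supp (I.ideal⁻¹) ⊆ X}

end Ideals

end PruferDiv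

end

/-!
`Inv_X(D)` sits inside `Div_X(D)` because invertible ideals are divisorial. The argument has an
order-theoretic half and a ring-theoretic half.

*Order.* Suppose that `i : G → C` is an order embedding of an `ℓ`-group into a complete one, that
`i(G)` is cofinal, and that every element of `C` is the infimum of the elements of `G` above it.
Taking inverses, it is also the supremum of those below it, and density and the compatibility of `i`
with lattice operations follow. If `f : G → H` is order-continuous, then `x ↦ sup {f g | g ≤ x}`
extends it; the point is that this supremum equals `inf {f h | x ≤ h}`, since the quotients `g / h`
have supremum `1` in `G`, which `f` preserves
(`PruferDiv.OrderContinuousHom.le_of_isLUB_of_isGLB`). This is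
`PruferDiv.isLCompletion_of_isGLB_above`.

*Ideals.* In a Prüfer domain `(I + J)(I ∩ J) = I J`, as `I` and `J` are locally comparable. So sums
of invertible ideals are invertible and sums of `v`-invertible ideals are `v`-invertible, which makes
both groups lattice-ordered. Support conditions are handled through the predicate
`PruferDiv.MeetsOff`: membership of `I` in `Div_X(D)` means that `I` and `(D : I)` both meet `D ∖ P`
for every prime `P ∉ X`.

The supremum of a bounded family in `Div_X(D)` is its intersection `I`. It has to be shown that `I`
is `v`-invertible, that is, that `(I : I) = D`
(`PruferDiv.IsPruferDomain.mem_one_of_spanSingleton_mul_le`); here `X ⊆ Max(D)` enters. Compactness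
of `Spec(D) ∖ X` provides an invertible ideal `F ⊆ I` in `Inv_X(D)`
(`PruferDiv.IsPruferDomain.exists_isUnit_le`), which is cofinality, and then `I` is the union of the
ideals `F + x D` with `x ∈ I`, which all lie in `Inv_X(D)`; so `I` is the infimum of the elements
of `Inv_X(D)` above it.
-/

namespace PruferDiv

/-! ### Completions of lattice-ordered groups -/

section Completion

theorem IsLGroup.of_exists_inf {G : Type*} [CommGroup G] [PartialOrder G] [IsOrderedMonoid G]
    (h : ∀ a b : G, ∃ c, IsGLB {a, b} c) : IsLGroup G where
  isOrderedMonoid := inferInstance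
  exists_inf := h
  exists_sup a b := by
    obtain ⟨c, hc⟩ := h a⁻¹ b⁻¹
    refine ⟨c⁻¹, ?_⟩
    simpa [Set.inv_insert] using hc.inv

variable {G : Type u} {C : Type v} [CommGroup G] [PartialOrder G] [IsOrderedMonoid G]
  [CommGroup C] [PartialOrder C] [IsOrderedMonoid C] {i : G →* C}

theorem OrderContinuousHom.monotone {H : Type*} [CommGroup H] [PartialOrder H] {f : G →* H}
    (hf : OrderContinuousHom f) : Monotone f := by
  intro a b hab
  have h1 : IsLUB {a, b} b := ⟨by simp [hab], fun u hu => hu (by simp)⟩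
  exact (hf {a, b} b ⟨a, by simp⟩ h1).1 ⟨a, by simp, rfl⟩

theorem isLUB_below_of_isGLB_above
    (hglb : ∀ x : C, IsGLB {y | y ∈ Set.range i ∧ x ≤ y} x) (x : C) :
    IsLUB {y | y ∈ Set.range i ∧ y ≤ x} x := by
  refine ⟨fun y hy => hy.2, fun u hu => ?_⟩
  rw [← inv_le_inv_iff]
  refine (hglb x⁻¹).2 ?_
  rintro _ ⟨⟨g, rfl⟩, hg⟩
  rw [inv_le', ← map_inv]
  exact hu ⟨⟨g⁻¹, rfl⟩, by rw [map_inv]; exact inv_le'.mp hg⟩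

/-- If `a` is at once the supremum of `T ⊆ G` and the infimum of `U ⊆ G` in `C`, then the quotients
`g / h` with `g ∈ T` and `h ∈ U` have supremum `1` in `G`. An order-continuous `f` preserves this
supremum, so that in `H` no gap separates `f '' T` from `f '' U`. -/
theorem OrderContinuousHom.le_of_isLUB_of_isGLB (hle : ∀ a b : G, i a ≤ i b ↔ a ≤ b)
    {H : Type w} [CommGroup H] [PartialOrder H] [IsOrderedMonoid H] {f : G →* H}
    (hf : OrderContinuousHom f) {T U : Set G} {a : C} (hT : IsLUB (i '' T) a)
    (hU : IsGLB (i '' U) a) (hT0 : T.Nonempty) (hU0 : U.Nonempty) {b c : H}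
    (hb : ∀ g ∈ T, f g ≤ b) (hc : ∀ h ∈ U, c ≤ f h) : c ≤ b := by
  have hlub : IsLUB {z : G | ∃ g ∈ T, ∃ h ∈ U, z = g / h} 1 := by
    refine ⟨?_, fun z hz => ?_⟩
    · rintro _ ⟨g, hg, h, hh, rfl⟩
      rw [div_le_one', ← hle]
      exact (hT.1 ⟨g, hg, rfl⟩).trans (hU.1 ⟨h, hh, rfl⟩)
    · have h1 : ∀ h ∈ U, a ≤ i z * i h := by
        intro h hh
        refine hT.2 ?_
        rintro _ ⟨g, hg, rfl⟩
        rw [← map_mul, hle, ← div_le_iff_le_mul]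
        exact hz ⟨g, hg, h, hh, rfl⟩
      have h2 : a / i z ≤ a := by
        refine hU.2 ?_
        rintro _ ⟨h, hh, rfl⟩
        rw [div_le_iff_le_mul, mul_comm]
        exact h1 h hh
      rw [← hle, map_one]
      rw [div_le_iff_le_mul] at h2
      exact (le_mul_iff_one_le_right' a).mp h2
  obtain ⟨g₀, hg₀⟩ := hT0
  obtain ⟨h₀, hh₀⟩ := hU0
  have hne : {z : G | ∃ g ∈ T, ∃ h ∈ U, z = g / h}.Nonempty := ⟨_, g₀, hg₀, h₀, hh₀, rfl⟩
  have h3 : f 1 ≤ b / c := by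
    refine (hf _ 1 hne hlub).2 ?_
    rintro _ ⟨_, ⟨g, hg, h, hh, rfl⟩, rfl⟩
    rw [map_div]
    exact div_le_div'' (hb g hg) (hc h hh)
  rwa [map_one, one_le_div'] at h3

/-- Universal property of a dense embedding `i : G → C`: the extension of `f` sends `x` to the
supremum of the `f g` with `i g ≤ x`. -/
theorem existsUnique_lift (hle : ∀ a b : G, i a ≤ i b ↔ a ≤ b)
    (hglb : ∀ x : C, IsGLB {y | y ∈ Set.range i ∧ x ≤ y} x) (hcof : ∀ x : C, ∃ g, x ≤ i g)
    (H : Type w) [CommGroup H] [PartialOrder H] (hH : IsCompleteLGroup H)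
    (f : G →* H) (hf : OrderContinuousHom f) :
    ∃! F : C →* H, OrderContinuousHom F ∧ F.comp i = f := by
  have := hH.isLGroup.isOrderedMonoid
  have hlub := isLUB_below_of_isGLB_above hglb
  have hmono := hf.monotone
  have hlubG : ∀ x : C, IsLUB (i '' {g | i g ≤ x}) x := by
    intro x
    convert hlub x using 1
    ext y
    constructor
    · rintro ⟨g, hg, rfl⟩
      exact ⟨⟨g, rfl⟩, hg⟩
    · rintro ⟨⟨g, rfl⟩, hg⟩
      exact ⟨g, hg, rfl⟩
  have hglbG : ∀ x : C, IsGLB (i '' {g | x ≤ i g}) x := by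
    intro x
    convert hglb x using 1
    ext y
    constructor
    · rintro ⟨g, hg, rfl⟩
      exact ⟨⟨g, rfl⟩, hg⟩
    · rintro ⟨⟨g, rfl⟩, hg⟩
      exact ⟨g, hg, rfl⟩
  have hcoi : ∀ x : C, {g | i g ≤ x}.Nonempty := by
    intro x
    obtain ⟨g, hg⟩ := hcof x⁻¹
    exact ⟨g⁻¹, show i g⁻¹ ≤ x by rw [map_inv]; exact inv_le'.mp hg⟩
  have hex : ∀ x : C, ∃ y : H, IsLUB (f '' {g | i g ≤ x}) y := by
    intro x
    refine hH.exists_isLUB _ ((hcoi x).image _) ?_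
    obtain ⟨h, hh⟩ := hcof x
    refine ⟨f h, ?_⟩
    rintro _ ⟨g, hg, rfl⟩
    exact hmono ((hle g h).mp (le_trans hg hh))
  choose F hF using hex
  have hFi : ∀ g, F (i g) = f g := by
    intro g
    refine (hF (i g)).unique ⟨?_, fun u hu => hu ⟨g, le_rfl, rfl⟩⟩
    rintro _ ⟨g', hg', rfl⟩
    exact hmono ((hle _ _).mp hg')
  have hF_le : ∀ x h, x ≤ i h → F x ≤ f h := by
    intro x h hx
    refine (hF x).2 ?_
    rintro _ ⟨g, hg, rfl⟩
    exact hmono ((hle g h).mp (le_trans hg hx))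
  have hle_F : ∀ x g, i g ≤ x → f g ≤ F x := fun x g hg => (hF x).1 ⟨g, hg, rfl⟩
  -- The same element is also the infimum of the values above `x`.
  have hFglb : ∀ x, IsGLB (f '' {g | x ≤ i g}) (F x) := by
    intro x
    refine ⟨?_, fun c hc => ?_⟩
    · rintro _ ⟨h, hh, rfl⟩
      exact hF_le x h hh
    · exact hf.le_of_isLUB_of_isGLB hle (hlubG x) (hglbG x) (hcoi x) (hcof x)
        (hle_F x) fun h hh => hc ⟨h, hh, rfl⟩
  have hmul : ∀ x y, F (x * y) = F x * F y := by
    intro x y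
    apply le_antisymm
    · rw [← div_le_iff_le_mul]
      refine (hFglb x).2 ?_
      rintro _ ⟨h, hh, rfl⟩
      rw [div_le_iff_le_mul, ← div_le_iff_le_mul']
      refine (hFglb y).2 ?_
      rintro _ ⟨h', hh', rfl⟩
      rw [div_le_iff_le_mul', ← map_mul]
      exact hF_le _ _ (by rw [map_mul]; exact mul_le_mul' hh hh')
    · rw [← le_div_iff_mul_le]
      refine (hF x).2 ?_
      rintro _ ⟨h, hh, rfl⟩
      rw [le_div_iff_mul_le, ← le_div_iff_mul_le']
      refine (hF y).2 ?_
      rintro _ ⟨h', hh', rfl⟩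
      rw [le_div_iff_mul_le', ← map_mul]
      exact hle_F _ _ (by rw [map_mul]; exact mul_le_mul' hh hh')
  refine ⟨MonoidHom.mk' F hmul, ⟨?_, MonoidHom.ext hFi⟩, ?_⟩
  · rintro S a ⟨s₀, hs₀⟩ ha
    refine ⟨?_, fun b hb => ?_⟩
    · rintro _ ⟨s, hs, rfl⟩
      refine (hF s).2 ?_
      rintro _ ⟨g, hg, rfl⟩
      exact hle_F a g (le_trans hg (ha.1 hs))
    · have hT : IsLUB (i '' {g | ∃ s ∈ S, i g ≤ s}) a := by
        refine ⟨?_, fun c hc => ha.2 fun s hs => (hlubG s).2 ?_⟩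
        · rintro _ ⟨g, ⟨s, hs, hg⟩, rfl⟩
          exact le_trans hg (ha.1 hs)
        · rintro _ ⟨g, hg, rfl⟩
          exact hc ⟨g, ⟨s, hs, hg⟩, rfl⟩
      obtain ⟨g₀, hg₀⟩ := hcoi s₀
      refine hf.le_of_isLUB_of_isGLB hle hT (hglbG a) ⟨g₀, s₀, hs₀, hg₀⟩ (hcof a) ?_ (hF_le a)
      rintro g ⟨s, hs, hg⟩
      exact (hle_F s g hg).trans (hb ⟨s, hs, rfl⟩)
  · rintro F' ⟨hF', rfl⟩
    ext x
    have h1 := hF' _ x ((hcoi x).image _) (hlubG x)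
    rw [Set.image_image] at h1
    exact h1.unique (hF x)

/-- A cofinal embedding of ordered groups in which every element of `C` is the infimum of the
elements of `G` above it is a completion as soon as `G` is an `ℓ`-group and `C` is complete. -/
theorem isLCompletion_of_isGLB_above (hG : IsLGroup G) (hC : IsCompleteLGroup C)
    (hle : ∀ a b : G, i a ≤ i b ↔ a ≤ b)
    (hglb : ∀ x : C, IsGLB {y | y ∈ Set.range i ∧ x ≤ y} x) (hcof : ∀ x : C, ∃ g, x ≤ i g) :
    IsLCompletion.{u, v, w} i := by
  have hlub := isLUB_below_of_isGLB_above hglb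
  have hsup : ∀ a b c : G, IsLUB {a, b} c → IsLUB {i a, i b} (i c) := by
    intro a b c hc
    have hac : a ≤ c := hc.1 (by simp)
    have hbc : b ≤ c := hc.1 (by simp)
    refine ⟨by simp [upperBounds_insert, hle, hac, hbc], fun u hu => (hglb u).2 ?_⟩
    rintro _ ⟨⟨g, rfl⟩, hg⟩
    refine (hle _ _).mpr (hc.2 ?_)
    have h1 := (hu (show i a ∈ _ by simp)).trans hg
    have h2 := (hu (show i b ∈ _ by simp)).trans hg
    rw [hle] at h1 h2
    simp [upperBounds_insert, h1, h2]
  have hinf : ∀ a b c : G, IsGLB {a, b} c → IsGLB {i a, i b} (i c) := by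
    intro a b c hc
    have hac : c ≤ a := hc.1 (by simp)
    have hbc : c ≤ b := hc.1 (by simp)
    refine ⟨by simp [lowerBounds_insert, hle, hac, hbc], fun u hu => (hlub u).2 ?_⟩
    rintro _ ⟨⟨g, rfl⟩, hg⟩
    refine (hle _ _).mpr (hc.2 ?_)
    have h1 := hg.trans (hu (show i a ∈ _ by simp))
    have h2 := hg.trans (hu (show i b ∈ _ by simp))
    rw [hle] at h1 h2
    simp [lowerBounds_insert, h1, h2]
  refine ⟨hG, hC, hle, hsup, hinf, fun x hx => ?_, hlub, hglb, fun H _ _ hH f hf =>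
    existsUnique_lift hle hglb hcof H hH f hf⟩
  obtain ⟨g', hg'⟩ := hcof x
  -- Some `g` below `x` is not below `1`, and then `g ⊔ 1` is strictly between `1` and `x`.
  obtain ⟨g, hgx, hg1⟩ : ∃ g, i g ≤ x ∧ ¬ i g ≤ 1 := by
    by_contra! hcon
    refine hx.not_ge ((hlub x).2 ?_)
    rintro _ ⟨⟨g, rfl⟩, hg⟩
    exact hcon g hg
  obtain ⟨c, hc⟩ := hG.exists_sup g 1
  have hc' := hsup _ _ _ hc
  have h1 : i g ≤ i c := hc'.1 (by simp)
  have h2 : 1 ≤ i c := hc'.1 (by simp)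
  refine ⟨c, g', lt_of_le_of_ne h2 fun h => hg1 (h ▸ h1), hc'.2 ?_, hg'⟩
  simp [upperBounds_insert, hgx, hx.le]

end Completion

section Ideals

variable {D : Type u} [CommRing D] [IsDomain D] {K : Type v} [Field K] [Algebra D K]
  [IsFractionRing D K]

theorem smul_mem (I : FractionalIdeal D⁰ K) (s : D) {x : K} (hx : x ∈ I) : s • x ∈ I :=
  Submodule.smul_mem (I : Submodule D K) s hx

theorem algebraMap_mul_mem {I : FractionalIdeal D⁰ K} {s : D} (hs : algebraMap D K s ∈ I) (t : D) :
    algebraMap D K (s * t) ∈ I := by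
  rw [mul_comm, map_mul, ← Algebra.smul_def]
  exact smul_mem I t hs

theorem algebraMap_mem_one (s : D) : algebraMap D K s ∈ (1 : FractionalIdeal D⁰ K) :=
  (FractionalIdeal.mem_one_iff D⁰).mpr ⟨s, rfl⟩

/-! ### Arithmetic of Prüfer domains -/

/-- The localization at `P` being a valuation ring, one of `x, y ∈ K` divides the other in it. -/
theorem IsPruferDomain.exists_smul_eq (hD : IsPruferDomain D) (P : Ideal D) [P.IsPrime] (x y : K) :
    ∃ s : D, s ∉ P ∧ ∃ a : D, s • y = a • x ∨ s • x = a • y := by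
  have := hD P
  obtain ⟨p, q, d, hd, rfl, rfl⟩ : ∃ p q d : D, algebraMap D K d ≠ 0 ∧
      x = algebraMap D K p / algebraMap D K d ∧ y = algebraMap D K q / algebraMap D K d := by
    obtain ⟨p, d, hd, rfl⟩ := IsFractionRing.div_surjective (A := D) x
    obtain ⟨q, e, he, rfl⟩ := IsFractionRing.div_surjective (A := D) y
    have hd' : algebraMap D K d ≠ 0 := by simpa using nonZeroDivisors.ne_zero hd
    have he' : algebraMap D K e ≠ 0 := by simpa using nonZeroDivisors.ne_zero he
    refine ⟨p * e, q * d, d * e, by simp_all, ?_, ?_⟩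
    · rw [map_mul, map_mul]; field_simp
    · rw [map_mul, map_mul]; field_simp
  have key : ∀ p q : D, algebraMap D (Localization.AtPrime P) p ∣
      algebraMap D (Localization.AtPrime P) q → ∃ s : D, s ∉ P ∧ ∃ a : D, s * q = a * p := by
    rintro p q ⟨c, hc⟩
    obtain ⟨a, s, rfl⟩ := IsLocalization.exists_mk'_eq P.primeCompl c
    refine ⟨s, s.2, a, IsLocalization.injective (Localization.AtPrime P)
      P.primeCompl_le_nonZeroDivisors ?_⟩
    rw [map_mul, map_mul, hc, ← IsLocalization.mk'_spec (Localization.AtPrime P) a s]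
    ring
  have aux : ∀ p q s a : D, s * q = a * p → s • (algebraMap D K q / algebraMap D K d) =
      a • (algebraMap D K p / algebraMap D K d) := by
    intro p q s a h
    rw [Algebra.smul_def, Algebra.smul_def, ← mul_div_assoc, ← mul_div_assoc, ← map_mul, h, map_mul]
  rcases ValuationRing.dvd_total (algebraMap D (Localization.AtPrime P) p)
    (algebraMap D (Localization.AtPrime P) q) with h | h
  · obtain ⟨s, hs, a, h⟩ := key p q h
    exact ⟨s, hs, a, Or.inl (aux _ _ _ _ h)⟩
  · obtain ⟨s, hs, a, h⟩ := key q p h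
    exact ⟨s, hs, a, Or.inr (aux _ _ _ _ h)⟩

/-- The local comparabilities of `x` and `y` glue to a partition of unity. -/
theorem IsPruferDomain.exists_add_eq_one (hD : IsPruferDomain D) (x y : K) :
    ∃ s t : D, s + t = 1 ∧ (∃ a : D, s • y = a • x) ∧ ∃ b : D, t • x = b • y := by
  let A : Ideal D := (Submodule.span D {x}).comap (LinearMap.toSpanSingleton D K y)
  let B : Ideal D := (Submodule.span D {y}).comap (LinearMap.toSpanSingleton D K x)
  have hA : ∀ s, s ∈ A ↔ ∃ a : D, s • y = a • x := by
    intro s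
    simp [A, Submodule.mem_span_singleton, eq_comm]
  have hB : ∀ s, s ∈ B ↔ ∃ a : D, s • x = a • y := by
    intro s
    simp [B, Submodule.mem_span_singleton, eq_comm]
  have htop : A ⊔ B = ⊤ := by
    by_contra hne
    obtain ⟨P, hP, hle⟩ := Ideal.exists_le_maximal _ hne
    obtain ⟨s, hs, a, h | h⟩ := hD.exists_smul_eq P x y
    · exact hs (hle (Ideal.mem_sup_left ((hA s).mpr ⟨a, h⟩)))
    · exact hs (hle (Ideal.mem_sup_right ((hB s).mpr ⟨a, h⟩)))
  obtain ⟨s, hs, t, ht, hst⟩ := Submodule.mem_sup.mp (htop ▸ Submodule.mem_top : (1 : D) ∈ A ⊔ B)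
  exact ⟨s, t, hst, (hA s).mp hs, (hB t).mp ht⟩

/-- The identity `(I + J)(I ∩ J) = I J`, which holds in Prüfer domains because it holds locally. -/
theorem IsPruferDomain.sup_mul_inf (hD : IsPruferDomain D) (I J : FractionalIdeal D⁰ K) :
    (I ⊔ J) * (I ⊓ J) = I * J := by
  apply le_antisymm
  · rw [FractionalIdeal.sup_eq_add, add_mul, ← FractionalIdeal.sup_eq_add]
    refine sup_le (by gcongr; exact inf_le_right) ?_
    rw [mul_comm]
    gcongr
    exact inf_le_left
  · rw [FractionalIdeal.mul_le]
    intro x hx y hy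
    obtain ⟨s, t, hst, ⟨a, ha⟩, b, hb⟩ := hD.exists_add_eq_one x y
    have h : x * y = x * (s • y) + y * (t • x) := by
      have : algebraMap D K s + algebraMap D K t = 1 := by rw [← map_add, hst, map_one]
      rw [Algebra.smul_def, Algebra.smul_def]
      linear_combination (-(x * y)) * this
    rw [h]
    refine (FractionalIdeal.mem_coe (S := D⁰)).mp (add_mem ?_ ?_)
    · refine FractionalIdeal.mul_mem_mul (le_sup_left (a := I) hx) ⟨?_, smul_mem J s hy⟩
      exact ha ▸ smul_mem I a hx
    · refine FractionalIdeal.mul_mem_mul (le_sup_right (b := J) hy) ⟨smul_mem I t hx, ?_⟩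
      exact hb ▸ smul_mem J b hy

theorem IsPruferDomain.isUnit_sup (hD : IsPruferDomain D) {I J : FractionalIdeal D⁰ K}
    (hI : IsUnit I) (hJ : IsUnit J) : IsUnit (I ⊔ J) :=
  isUnit_of_mul_isUnit_left (hD.sup_mul_inf I J ▸ hI.mul hJ)

theorem isUnit_spanSingleton {x : K} (hx : x ≠ 0) :
    IsUnit (FractionalIdeal.spanSingleton D⁰ x) :=
  IsUnit.of_mul_eq_one (FractionalIdeal.spanSingleton D⁰ x⁻¹) (by
    rw [FractionalIdeal.spanSingleton_mul_spanSingleton, mul_inv_cancel₀ hx,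
      FractionalIdeal.spanSingleton_one])

theorem IsPruferDomain.isUnit_sup_spanSingleton (hD : IsPruferDomain D) {I : FractionalIdeal D⁰ K}
    (hI : IsUnit I) (x : K) : IsUnit (I ⊔ FractionalIdeal.spanSingleton D⁰ x) := by
  by_cases hx : x = 0
  · rw [hx, FractionalIdeal.spanSingleton_zero, sup_of_le_left (FractionalIdeal.zero_le I)]
    exact hI
  · exact hD.isUnit_sup hI (isUnit_spanSingleton hx)

theorem IsVInvertible.ne_zero {I : FractionalIdeal D⁰ K} (hI : IsVInvertible I) : I ≠ 0 := by
  rintro rfl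
  obtain ⟨J, hJ⟩ := hI
  rw [zero_mul, vClosure_zero] at hJ
  exact zero_ne_one hJ

theorem isVInvertible_of_isUnit {I : FractionalIdeal D⁰ K} (hI : IsUnit I) : IsVInvertible I := by
  obtain ⟨J, hJ⟩ := hI.exists_right_inv
  exact ⟨J, by rw [hJ, vClosure_one]⟩

theorem eq_vClosure_of_isUnit {I : FractionalIdeal D⁰ K} (hI : IsUnit I) : I = vClosure I := by
  obtain ⟨J, hJ⟩ := hI.exists_right_inv
  have h1 := FractionalIdeal.right_inverse_eq K I J hJ
  rw [vClosure, ← h1]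
  exact FractionalIdeal.right_inverse_eq K J I (by rw [mul_comm, hJ])

theorem IsPruferDomain.isVInvertible_sup (hD : IsPruferDomain D) {I J : FractionalIdeal D⁰ K}
    (hI : IsVInvertible I) (hJ : IsVInvertible J) : IsVInvertible (I ⊔ J) := by
  obtain ⟨I', hI'⟩ := hI
  obtain ⟨J', hJ'⟩ := hJ
  refine ⟨(I ⊓ J) * (I' * J'), ?_⟩
  rw [← mul_assoc, hD.sup_mul_inf, mul_mul_mul_comm, ← vClosure_vClosure_mul, hI', one_mul, hJ']

theorem IsVInvertible.vClosure {I : FractionalIdeal D⁰ K} (hI : IsVInvertible I) :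
    IsVInvertible (vClosure I) := by
  obtain ⟨J, hJ⟩ := hI
  exact ⟨J, by rw [vClosure_vClosure_mul, hJ]⟩

/-! ### The group `Div(D)` -/

theorem DivGroup.mul_ideal (I J : DivGroup D K) :
    (I * J).ideal = PruferDiv.vClosure (I.ideal * J.ideal) := rfl

theorem DivGroup.inv_ideal (I : DivGroup D K) : (I⁻¹).ideal = I.ideal⁻¹ := rfl

theorem DivGroup.one_ideal : (1 : DivGroup D K).ideal = 1 := rfl

instance : IsOrderedMonoid (DivGroup D K) where
  mul_le_mul_left I J h L := by
    rw [DivGroup.le_iff, DivGroup.mul_ideal, DivGroup.mul_ideal]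
    refine vClosure_mono ?_
    have := (DivGroup.le_iff I J).mp h
    gcongr

instance : IsOrderedMonoid (InvGroup D K) where
  mul_le_mul_left I J h L := by
    rw [InvGroup.le_iff, InvGroup.ideal_mul, InvGroup.ideal_mul]
    have := (InvGroup.le_iff I J).mp h
    gcongr

theorem IsPruferDomain.isLGroup_divGroup (hD : IsPruferDomain D) : IsLGroup (DivGroup D K) := by
  refine IsLGroup.of_exists_inf fun I J => ?_
  refine ⟨⟨vClosure (I.ideal ⊔ J.ideal), (vClosure_vClosure _).symm,
    (hD.isVInvertible_sup I.vInvertible J.vInvertible).vClosure⟩, ?_, fun L hL => ?_⟩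
  · have h := le_vClosure (I.ideal ⊔ J.ideal)
    rintro _ (rfl | rfl)
    · exact le_sup_left.trans h
    · exact le_sup_right.trans h
  · have h1 : I.ideal ≤ L.ideal := hL (by simp)
    have h2 : J.ideal ≤ L.ideal := hL (by simp)
    rw [DivGroup.le_iff, L.divisorial]
    exact vClosure_mono (sup_le h1 h2)

/-! ### Supports -/

/-- `I` meets `D ∖ P` for every prime `P ∉ X`, that is, `V(I ∩ D) ⊆ X`. -/
def MeetsOff (X : Set (PrimeSpectrum D)) (I : FractionalIdeal D⁰ K) : Prop :=
  ∀ P ∉ X, ∃ c : D, c ∉ P.asIdeal ∧ algebraMap D K c ∈ I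

variable {X : Set (PrimeSpectrum D)} {I J : FractionalIdeal D⁰ K}

theorem MeetsOff.mono (hI : MeetsOff X I) (h : I ≤ J) : MeetsOff X J := fun P hP =>
  let ⟨c, hc, hcI⟩ := hI P hP
  ⟨c, hc, h hcI⟩

theorem meetsOff_one : MeetsOff X (1 : FractionalIdeal D⁰ K) := fun P _ =>
  ⟨1, P.asIdeal.one_notMem, algebraMap_mem_one 1⟩

theorem MeetsOff.mul (hI : MeetsOff X I) (hJ : MeetsOff X J) : MeetsOff X (I * J) := by
  intro P hP
  obtain ⟨c, hc, hcI⟩ := hI P hP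
  obtain ⟨d, hd, hdJ⟩ := hJ P hP
  exact ⟨c * d, P.asIdeal.primeCompl.mul_mem hc hd,
    by rw [map_mul]; exact FractionalIdeal.mul_mem_mul hcI hdJ⟩

theorem MeetsOff.inf (hI : MeetsOff X I) (hJ : MeetsOff X J) : MeetsOff X (I ⊓ J) := by
  intro P hP
  obtain ⟨c, hc, hcI⟩ := hI P hP
  obtain ⟨d, hd, hdJ⟩ := hJ P hP
  exact ⟨c * d, P.asIdeal.primeCompl.mul_mem hc hd, algebraMap_mul_mem hcI d,
    by rw [mul_comm]; exact algebraMap_mul_mem hdJ c⟩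

theorem mem_locAt {P : PrimeSpectrum D} {x : K} :
    x ∈ locAt K P ↔ ∃ a s : D, s ∉ P.asIdeal ∧ s • x = algebraMap D K a := by
  change (∃ (a s : D) (_ : s ∈ P.asIdeal.primeCompl),
    x = algebraMap D K a * (algebraMap D K s)⁻¹) ↔ _
  have h0 : ∀ s : D, s ∉ P.asIdeal → algebraMap D K s ≠ 0 := by
    rintro s hs h
    rw [(FaithfulSMul.algebraMap_eq_zero_iff D K).mp h] at hs
    exact hs P.asIdeal.zero_mem
  constructor
  · rintro ⟨a, s, hs, rfl⟩
    exact ⟨a, s, hs, by rw [Algebra.smul_def]; field_simp [h0 s hs]⟩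
  · rintro ⟨a, s, hs, h⟩
    refine ⟨a, s, hs, ?_⟩
    rw [← h, Algebra.smul_def]
    field_simp [h0 s hs]

theorem exists_mem_of_notMem_supp {P : PrimeSpectrum D} (h : P ∉ supp I) :
    ∃ c : D, c ∉ P.asIdeal ∧ algebraMap D K c ∈ I := by
  have h1 : (I : Submodule D K) * locAt K P = locAt K P := not_not.mp h
  have h2 : (1 : K) ∈ (I : Submodule D K) * locAt K P := by
    rw [h1]
    exact (Localization.subalgebra.ofField K P.asIdeal.primeCompl
      P.asIdeal.primeCompl_le_nonZeroDivisors).one_mem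
  have h3 : ∀ x ∈ (I : Submodule D K) * locAt K P, ∃ s : D, s ∉ P.asIdeal ∧ s • x ∈ I := by
    intro x hx
    refine Submodule.mul_induction_on hx ?_ ?_
    · intro m hm n hn
      obtain ⟨a, s, hs, h⟩ := mem_locAt.mp hn
      refine ⟨s, hs, ?_⟩
      rw [← mul_smul_comm, h, mul_comm, ← Algebra.smul_def]
      exact smul_mem I a hm
    · rintro x y ⟨s, hs, hx⟩ ⟨t, ht, hy⟩
      refine ⟨s * t, P.asIdeal.primeCompl.mul_mem hs ht, ?_⟩
      rw [smul_add]
      refine (FractionalIdeal.mem_coe (S := D⁰)).mp (add_mem ?_ ?_)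
      · rw [mul_comm, mul_smul]
        exact smul_mem I t hx
      · rw [mul_smul]
        exact smul_mem I s hy
  obtain ⟨s, hs, h⟩ := h3 1 h2
  exact ⟨s, hs, by rwa [Algebra.smul_def, mul_one] at h⟩

/-- The element `d ∈ B ∖ P` bounds the denominators of `I`, so that `I D_P ⊆ D_P`. -/
theorem notMem_supp {P : PrimeSpectrum D} {B : FractionalIdeal D⁰ K} (hIB : I * B ≤ 1)
    (hI : ∃ c : D, c ∉ P.asIdeal ∧ algebraMap D K c ∈ I)
    (hB : ∃ c : D, c ∉ P.asIdeal ∧ algebraMap D K c ∈ B) : P ∉ supp I := by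
  obtain ⟨c, hc, hcI⟩ := hI
  obtain ⟨d, hd, hdB⟩ := hB
  refine not_not.mpr (le_antisymm ?_ ?_)
  · rw [Submodule.mul_le]
    intro x hx y hy
    obtain ⟨a, s, hs, h⟩ := mem_locAt.mp hy
    obtain ⟨b, hb⟩ := (FractionalIdeal.mem_one_iff D⁰).mp
      (hIB (FractionalIdeal.mul_mem_mul hx hdB))
    refine mem_locAt.mpr ⟨b * a, d * s, P.asIdeal.primeCompl.mul_mem hd hs, ?_⟩
    rw [map_mul, hb, ← h, Algebra.smul_def, Algebra.smul_def, map_mul]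
    ring
  · intro x hx
    obtain ⟨a, s, hs, h⟩ := mem_locAt.mp hx
    have hc0 : algebraMap D K c ≠ 0 := by
      intro h
      rw [(FaithfulSMul.algebraMap_eq_zero_iff D K).mp h] at hc
      exact hc P.asIdeal.zero_mem
    have h1 : x = algebraMap D K c * ((algebraMap D K c)⁻¹ * x) := by
      rw [mul_inv_cancel_left₀ hc0]
    rw [h1]
    refine Submodule.mul_mem_mul hcI (mem_locAt.mpr ⟨a, c * s,
      P.asIdeal.primeCompl.mul_mem hc hs, ?_⟩)
    rw [← h, Algebra.smul_def, Algebra.smul_def, map_mul]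
    field_simp

/-- The supports of `I` and `(D : I)` lie in `X` exactly when both ideals meet `D ∖ P` for
`P ∉ X`: each of the two then bounds the denominators of the other. -/
theorem supp_subset_and_supp_inv_subset_iff :
    (supp I ⊆ X ∧ supp I⁻¹ ⊆ X) ↔ MeetsOff X I ∧ MeetsOff X I⁻¹ := by
  constructor
  · rintro ⟨h1, h2⟩
    exact ⟨fun P hP => exists_mem_of_notMem_supp fun h => hP (h1 h),
      fun P hP => exists_mem_of_notMem_supp fun h => hP (h2 h)⟩
  · rintro ⟨h1, h2⟩
    constructor
    · intro P hP
      by_contra hPX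
      exact notMem_supp (mul_inv_le_one I) (h1 P hPX) (h2 P hPX) hP
    · intro P hP
      by_contra hPX
      exact notMem_supp (by rw [mul_comm]; exact mul_inv_le_one I) (h2 P hPX) (h1 P hPX) hP

theorem mem_divX_iff {I : DivGroup D K} :
    I ∈ divX K X ↔ MeetsOff X I.ideal ∧ MeetsOff X I.ideal⁻¹ :=
  supp_subset_and_supp_inv_subset_iff

theorem InvGroup.ideal_inv (I : InvGroup D K) : InvGroup.ideal I⁻¹ = (InvGroup.ideal I)⁻¹ :=
  FractionalIdeal.right_inverse_eq K _ _ (by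
    rw [← InvGroup.ideal_mul, mul_inv_cancel, InvGroup.ideal_one])

theorem mem_invX_iff {I : InvGroup D K} :
    I ∈ invX K X ↔ MeetsOff X (InvGroup.ideal I) ∧ MeetsOff X (InvGroup.ideal I)⁻¹ := by
  rw [← supp_subset_and_supp_inv_subset_iff]
  refine ⟨fun h => ⟨h, ?_⟩, fun h => h.1⟩
  rw [← InvGroup.ideal_inv]
  exact (invX K X).inv_mem h

variable (K X) in
/-- `Div_X(D)` as a subgroup of `Div(D)`. -/
def divXSubgroup : Subgroup (DivGroup D K) where
  carrier := divX K X
  one_mem' := by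
    rw [mem_divX_iff, DivGroup.one_ideal]
    exact ⟨meetsOff_one, by simpa using meetsOff_one⟩
  mul_mem' := by
    intro I J hI hJ
    rw [mem_divX_iff] at hI hJ ⊢
    rw [DivGroup.mul_ideal, inv_vClosure]
    refine ⟨(hI.1.mul hJ.1).mono (le_vClosure _), (hI.2.mul hJ.2).mono ?_⟩
    refine le_inv_of_mul_le_one (ideal_mul_ne_zero I.vInvertible.ne_zero J.vInvertible.ne_zero) ?_
    rw [mul_comm, mul_mul_mul_comm]
    calc I.ideal * I.ideal⁻¹ * (J.ideal * J.ideal⁻¹) ≤ 1 * 1 := by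
          gcongr
          · exact mul_inv_le_one _
          · exact mul_inv_le_one _
      _ = 1 := one_mul 1
  inv_mem' := by
    intro I hI
    rw [mem_divX_iff] at hI ⊢
    rw [DivGroup.inv_ideal]
    exact ⟨hI.2, hI.1.mono (le_vClosure _)⟩

theorem mem_divXSubgroup_iff {I : DivGroup D K} :
    I ∈ divXSubgroup K X ↔ MeetsOff X I.ideal ∧ MeetsOff X I.ideal⁻¹ :=
  mem_divX_iff

theorem ordConnected_divX : (divX K X).OrdConnected := by
  refine ⟨fun I hI J hJ L hL => ?_⟩
  rw [mem_divX_iff] at hI hJ ⊢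
  exact ⟨hJ.1.mono hL.2, hI.2.mono (inv_anti L.vInvertible.ne_zero hL.1)⟩

/-! ### Completeness -/

/-- If `x I ⊆ I` but `x ∉ D`, take a maximal ideal `P` containing the conductor `(D : x)`. Off `X`
this contradicts `I D_P = D_P`. If `P ∈ X`, then `s = a x` with `a ∈ P` and `s ∉ P`. As the
elements of `X` are maximal, a prime strictly below `P` is off `X`, so `I ∩ B ∩ D` contains a power
of `a` locally at `P`: `aⁿ u ∈ I ∩ B` with `u ∉ P`. Hence `xᵐ (aⁿ u)² ∈ D` for all `m`, and for
`m = 2 n + 1` this puts `sᵐ u²` into `a D ⊆ P`. -/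
theorem IsPruferDomain.mem_one_of_spanSingleton_mul_le (hD : IsPruferDomain D)
    (hmax : ∀ P ∈ X, P.asIdeal.IsMaximal) {B : FractionalIdeal D⁰ K} (hI : MeetsOff X I)
    (hB : MeetsOff X B) (hIB : I * B ≤ 1) {x : K}
    (hx : FractionalIdeal.spanSingleton D⁰ x * I ≤ I) : x ∈ (1 : FractionalIdeal D⁰ K) := by
  have hxI : ∀ y ∈ I, x * y ∈ I := fun y hy =>
    hx (FractionalIdeal.mul_mem_mul (FractionalIdeal.mem_spanSingleton_self D⁰ x) hy)
  have hpow : ∀ m : ℕ, ∀ y ∈ I, x ^ m * y ∈ I := by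
    intro m
    induction m with
    | zero => simp
    | succ m ih =>
      intro y hy
      rw [pow_succ', mul_assoc]
      exact hxI _ (ih y hy)
  let A : Ideal D := (1 : Submodule D K).comap (LinearMap.toSpanSingleton D K x)
  have hA : ∀ d : D, d ∈ A ↔ ∃ b : D, algebraMap D K b = d • x := by
    intro d
    simp [A, Submodule.mem_one]
  by_cases htop : A = ⊤
  · obtain ⟨b, hb⟩ := (hA 1).mp (htop ▸ Submodule.mem_top)
    rw [one_smul] at hb
    exact hb ▸ algebraMap_mem_one b
  exfalso
  obtain ⟨P, hP, hAP⟩ := Ideal.exists_le_maximal A htop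
  have hPp : P.IsPrime := hP.isPrime
  by_cases hPX : (⟨P, hPp⟩ : PrimeSpectrum D) ∈ X
  swap
  · obtain ⟨c, hc, hcI⟩ := hI _ hPX
    obtain ⟨d, hd, hdB⟩ := hB _ hPX
    obtain ⟨b, hb⟩ := (FractionalIdeal.mem_one_iff D⁰).mp
      (hIB (FractionalIdeal.mul_mem_mul (hxI _ hcI) hdB))
    refine P.primeCompl.mul_mem hc hd (hAP ((hA _).mpr ⟨b, ?_⟩))
    rw [hb, Algebra.smul_def, map_mul]
    ring
  obtain ⟨s, hs, a, h | h⟩ := hD.exists_smul_eq P x 1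
  swap
  · exact hs (hAP ((hA s).mpr ⟨a, by rw [h, Algebra.smul_def, mul_one]⟩))
  rw [Algebra.smul_def, mul_one, Algebra.smul_def] at h
  have haP : a ∈ P := by
    by_contra haP
    exact haP (hAP ((hA a).mpr ⟨s, by rw [h, Algebra.smul_def]⟩))
  let J : Ideal D := ((I ⊓ B : FractionalIdeal D⁰ K) : Submodule D K).comap
    (Algebra.linearMap D K)
  have hJ : ∀ c, c ∈ J ↔ algebraMap D K c ∈ I ∧ algebraMap D K c ∈ B := fun c => Iff.rfl
  let M : Submonoid D := Submonoid.powers a ⊔ P.primeCompl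
  obtain ⟨j, hjJ, hjM⟩ : ∃ j ∈ J, j ∈ M := by
    by_contra! hcon
    obtain ⟨Q, hQ, hJQ, hQM⟩ := Ideal.exists_le_prime_disjoint J M
      (Set.disjoint_left.mpr hcon)
    rw [Set.disjoint_left] at hQM
    have hQX : (⟨Q, hQ⟩ : PrimeSpectrum D) ∈ X := by
      by_contra hQX
      obtain ⟨c, hc, hcJ⟩ := (hI.inf hB) _ hQX
      exact hc (hJQ hcJ)
    have hQP : Q ≤ P := fun q hq => by
      by_contra hqP
      exact hQM hq (Submonoid.mem_sup_right hqP)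
    have hQP' : Q = P := (hmax _ hQX).eq_of_le hP.ne_top hQP
    have haQ : a ∈ Q := by rw [hQP']; exact haP
    exact hQM haQ (Submonoid.mem_sup_left (Submonoid.mem_powers a))
  obtain ⟨_, ⟨n, rfl⟩, u, hu, rfl⟩ := Submonoid.mem_sup.mp hjM
  obtain ⟨hjI, hjB⟩ := (hJ _).mp hjJ
  -- The exponent is `2 n + 1` because `aⁿ u` is used once for `I` and once for `B`.
  obtain ⟨b, hb⟩ := (FractionalIdeal.mem_one_iff D⁰).mp
    (hIB (FractionalIdeal.mul_mem_mul (hpow (2 * n + 1) _ hjI) hjB))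
  have h1 : s ^ (2 * n + 1) * u ^ 2 = a * b := by
    apply FaithfulSMul.algebraMap_injective D K
    simp only [map_mul, map_pow, hb, h]
    ring
  have h2 : s ^ (2 * n + 1) * u ^ 2 ∈ P.primeCompl :=
    mul_mem (pow_mem (show s ∈ P.primeCompl from hs) _) (pow_mem hu _)
  exact h2 (h1 ▸ P.mul_mem_right b haP)

/-- By `IsPruferDomain.mem_one_of_spanSingleton_mul_le`, `(D : I I⁻¹) = (I : I)` is equal to `D`. -/
theorem IsPruferDomain.isVInvertible_of_meetsOff (hD : IsPruferDomain D)
    (hmax : ∀ P ∈ X, P.asIdeal.IsMaximal) {B : FractionalIdeal D⁰ K} (hI0 : I ≠ 0)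
    (hdiv : I = vClosure I) (hI : MeetsOff X I) (hB : MeetsOff X B) (hIB : I * B ≤ 1) :
    IsVInvertible I := by
  refine ⟨I⁻¹, le_antisymm ((vClosure_mono (mul_inv_le_one I)).trans_eq vClosure_one) ?_⟩
  have h0 := inv_ne_zero_of_ne_zero hI0
  have h1 : (I * I⁻¹)⁻¹ ≤ 1 := by
    intro x hx
    refine hD.mem_one_of_spanSingleton_mul_le hmax hI hB hIB ?_
    conv_rhs => rw [hdiv]
    refine le_inv_of_mul_le_one h0 ?_
    rw [mul_assoc]
    calc FractionalIdeal.spanSingleton D⁰ x * (I * I⁻¹) ≤ (I * I⁻¹)⁻¹ * (I * I⁻¹) := by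
          gcongr
          exact FractionalIdeal.spanSingleton_le_iff_mem.mpr hx
      _ ≤ 1 := by rw [mul_comm]; exact mul_inv_le_one _
  refine le_inv_of_mul_le_one (inv_ne_zero_of_ne_zero (ideal_mul_ne_zero hI0 h0)) ?_
  rwa [one_mul]

/-- The supremum of a bounded family is the intersection of its members. -/
theorem IsPruferDomain.exists_isLUB_divX (hD : IsPruferDomain D)
    (hmax : ∀ P ∈ X, P.asIdeal.IsMaximal) (S : Set (divXSubgroup K X)) (hS : S.Nonempty)
    (hbdd : BddAbove S) : ∃ c, IsLUB S c := by
  obtain ⟨A, hA⟩ := hS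
  obtain ⟨C, hC⟩ := hbdd
  let N : Submodule D K := ⨅ L ∈ S, ((L : DivGroup D K).ideal : Submodule D K)
  have hN : N ≤ ((A : DivGroup D K).ideal : Submodule D K) := iInf₂_le A hA
  let I : FractionalIdeal D⁰ K := ⟨N, FractionalIdeal.isFractional_of_le hN⟩
  have hIL : ∀ L ∈ S, I ≤ (L : DivGroup D K).ideal := fun L hL =>
    show N ≤ ((L : DivGroup D K).ideal : Submodule D K) from iInf₂_le L hL
  have hleI : ∀ J : FractionalIdeal D⁰ K, (∀ L ∈ S, J ≤ (L : DivGroup D K).ideal) → J ≤ I :=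
    fun J h => show (J : Submodule D K) ≤ N from le_iInf₂ fun L hL => h L hL
  have hCI : (C : DivGroup D K).ideal ≤ I := hleI _ fun L hL => hC hL
  have hdiv : I = vClosure I := by
    refine le_antisymm (le_vClosure I) (hleI _ fun L hL => ?_)
    rw [(L : DivGroup D K).divisorial]
    exact vClosure_mono (hIL L hL)
  have hA' := mem_divXSubgroup_iff.mp A.2
  have hC' := mem_divXSubgroup_iff.mp C.2
  have hI0 : I ≠ 0 := fun h => (C : DivGroup D K).vInvertible.ne_zero (by simpa [h] using hCI)
  have hI : MeetsOff X I := hC'.1.mono hCI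
  have hinv : IsVInvertible I := by
    refine hD.isVInvertible_of_meetsOff hmax hI0 hdiv hI hA'.2 ?_
    calc I * (A : DivGroup D K).ideal⁻¹ ≤ (A : DivGroup D K).ideal * (A : DivGroup D K).ideal⁻¹ := by
          gcongr
          exact hIL A hA
      _ ≤ 1 := mul_inv_le_one _
  refine ⟨⟨⟨I, hdiv, hinv⟩, mem_divXSubgroup_iff.mpr ⟨hI, hA'.2.mono (inv_anti hI0 (hIL A hA))⟩⟩,
    fun L hL => hIL L hL, fun L hL => hleI _ fun L' hL' => hL hL'⟩

/-! ### The embedding of `Inv_X(D)` into `Div_X(D)` -/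

/-- Invertible ideals are divisorial and `v`-invertible, and on them the `v`-product is the ordinary
product. -/
noncomputable def invToDiv : InvGroup D K →* DivGroup D K where
  toFun I := ⟨InvGroup.ideal I, eq_vClosure_of_isUnit (OrderDual.ofDual I).isUnit,
    isVInvertible_of_isUnit (OrderDual.ofDual I).isUnit⟩
  map_one' := rfl
  map_mul' I J := DivGroup.ext (by
    change InvGroup.ideal (I * J) = vClosure (InvGroup.ideal I * InvGroup.ideal J)
    rw [← InvGroup.ideal_mul]
    exact eq_vClosure_of_isUnit (OrderDual.ofDual (I * J)).isUnit)

variable (K X) in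
/-- The inclusion `Inv_X(D) ⊆ Div_X(D)`. -/
noncomputable def invXToDivX : invX K X →* divXSubgroup K X :=
  (invToDiv.comp (invX K X).subtype).codRestrict (divXSubgroup K X) fun I =>
    mem_divXSubgroup_iff.mpr (mem_invX_iff.mp I.2)

theorem invXToDivX_ideal (I : invX K X) :
    (invXToDivX K X I : DivGroup D K).ideal = InvGroup.ideal (I : InvGroup D K) := rfl

theorem exists_invX_of_isUnit (hI : IsUnit I) (h1 : MeetsOff X I) (h2 : MeetsOff X I⁻¹) :
    ∃ L : invX K X, InvGroup.ideal (L : InvGroup D K) = I := by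
  obtain ⟨L, rfl⟩ := hI
  exact ⟨⟨OrderDual.toDual L, mem_invX_iff.mpr ⟨h1, h2⟩⟩, rfl⟩

theorem IsPruferDomain.isLGroup_invX (hD : IsPruferDomain D) : IsLGroup (invX K X) := by
  refine IsLGroup.of_exists_inf fun I J => ?_
  have hI := mem_invX_iff.mp I.2
  have hJ := mem_invX_iff.mp J.2
  have hu := hD.isUnit_sup (OrderDual.ofDual I.1).isUnit (OrderDual.ofDual J.1).isUnit
  have h0 := hu.ne_zero
  obtain ⟨L, hL⟩ := exists_invX_of_isUnit (X := X) hu (hI.1.mono le_sup_left) <|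
    (hI.2.inf hJ.2).mono <| le_inv_of_mul_le_one h0 (by
      rw [FractionalIdeal.sup_eq_add, mul_add, ← FractionalIdeal.sup_eq_add, mul_comm,
        mul_comm (_ ⊓ _)]
      refine sup_le ?_ ?_
      · exact le_trans (by gcongr; exact inf_le_left) (mul_inv_le_one _)
      · exact le_trans (by gcongr; exact inf_le_right) (mul_inv_le_one _))
  refine ⟨L, ?_, fun M hM => ?_⟩
  · rintro _ (rfl | rfl)
    · exact le_sup_left.trans_eq hL.symm
    · exact le_sup_right.trans_eq hL.symm
  · exact hL.le.trans (sup_le (hM (by simp)) (hM (by simp)))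

/-- Compactness of `Spec(D) ∖ X` yields one invertible ideal that meets `D ∖ P` for all `P ∉ X`: the
invertible ideals inside `I ∩ D` are directed under inclusion, and their non-vanishing loci
cover `Spec(D) ∖ X`. -/
theorem IsPruferDomain.exists_isUnit_le (hD : IsPruferDomain D) (hX : IsCompact Xᶜ) (hI0 : I ≠ 0)
    (hI : MeetsOff X I) :
    ∃ F : FractionalIdeal D⁰ K, IsUnit F ∧ F ≤ I ∧ MeetsOff X F ∧ MeetsOff X F⁻¹ := by
  let Λ := {F : FractionalIdeal D⁰ K // IsUnit F ∧ F ≤ I ∧ F ≤ 1}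
  have hprin : ∀ c : D, c ≠ 0 → algebraMap D K c ∈ I →
      IsUnit (FractionalIdeal.spanSingleton D⁰ (algebraMap D K c)) ∧
      FractionalIdeal.spanSingleton D⁰ (algebraMap D K c) ≤ I ∧
      FractionalIdeal.spanSingleton D⁰ (algebraMap D K c) ≤ 1 := fun c hc hcI =>
    ⟨isUnit_spanSingleton (by simpa using hc),
      FractionalIdeal.spanSingleton_le_iff_mem.mpr hcI,
      FractionalIdeal.spanSingleton_le_iff_mem.mpr (algebraMap_mem_one c)⟩
  have hne : Nonempty Λ := by
    obtain ⟨x, hx, hx0⟩ : ∃ x ∈ I, x ≠ 0 := by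
      by_contra! hcon
      exact hI0 (FractionalIdeal.eq_zero_iff.mpr hcon)
    obtain ⟨p, d, hd, rfl⟩ := IsFractionRing.div_surjective (A := D) x
    have hd' : algebraMap D K d ≠ 0 := by simpa using nonZeroDivisors.ne_zero hd
    have hp : p ≠ 0 := by
      rintro rfl
      simp at hx0
    refine ⟨⟨_, hprin p hp ?_⟩⟩
    have := smul_mem I d hx
    rwa [Algebra.smul_def, mul_div_cancel₀ _ hd'] at this
  let U : Λ → Set (PrimeSpectrum D) := fun F =>
    ⋃ c ∈ {c : D | algebraMap D K c ∈ F.1}, (PrimeSpectrum.basicOpen c : Set (PrimeSpectrum D))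
  have hU : ∀ F P, P ∈ U F ↔ ∃ c : D, c ∉ P.asIdeal ∧ algebraMap D K c ∈ F.1 := by
    intro F P
    simp only [U, Set.mem_iUnion, Set.mem_ofPred_eq, exists_prop, SetLike.mem_coe,
      PrimeSpectrum.mem_basicOpen]
    exact exists_congr fun c => and_comm
  have hcover : Xᶜ ⊆ ⋃ F, U F := by
    intro P hP
    obtain ⟨c, hc, hcI⟩ := hI P hP
    have hc0 : c ≠ 0 := by
      rintro rfl
      exact hc P.asIdeal.zero_mem
    exact Set.mem_iUnion.mpr ⟨⟨_, hprin c hc0 hcI⟩, (hU _ P).mpr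
      ⟨c, hc, FractionalIdeal.mem_spanSingleton_self D⁰ _⟩⟩
  have hdir : Directed (· ⊆ ·) U := by
    intro F G
    refine ⟨⟨F.1 ⊔ G.1, hD.isUnit_sup F.2.1 G.2.1, sup_le F.2.2.1 G.2.2.1,
      sup_le F.2.2.2 G.2.2.2⟩, ?_, ?_⟩
    · intro P hP
      obtain ⟨c, hc, hcF⟩ := (hU F P).mp hP
      exact (hU _ P).mpr ⟨c, hc, le_sup_left (a := F.1) hcF⟩
    · intro P hP
      obtain ⟨c, hc, hcG⟩ := (hU G P).mp hP
      exact (hU _ P).mpr ⟨c, hc, le_sup_right (b := G.1) hcG⟩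
  obtain ⟨F, hF⟩ := hX.elim_directed_cover U
    (fun F => isOpen_biUnion fun c _ => PrimeSpectrum.isOpen_basicOpen) hcover hdir
  refine ⟨F.1, F.2.1, F.2.2.1, fun P hP => (hU F P).mp (hF hP), meetsOff_one.mono ?_⟩
  exact le_inv_of_mul_le_one F.2.1.ne_zero (by rw [one_mul]; exact F.2.2.2)

theorem IsPruferDomain.exists_le_invXToDivX (hD : IsPruferDomain D) (hX : IsCompact Xᶜ)
    (I : divXSubgroup K X) : ∃ L : invX K X, I ≤ invXToDivX K X L := by
  obtain ⟨F, hF, hFI, h1, h2⟩ := hD.exists_isUnit_le hX (I : DivGroup D K).vInvertible.ne_zero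
    (mem_divXSubgroup_iff.mp I.2).1
  obtain ⟨L, rfl⟩ := exists_invX_of_isUnit hF h1 h2
  exact ⟨L, hFI⟩

/-- `I` is the union of the ideals `F + x D`, where `F ⊆ I` is a fixed member of `Inv_X(D)` and `x`
runs through `I`; these ideals again belong to `Inv_X(D)`. -/
theorem IsPruferDomain.isGLB_invX_above (hD : IsPruferDomain D) (hX : IsCompact Xᶜ)
    (I : divXSubgroup K X) : IsGLB {y | y ∈ Set.range (invXToDivX K X) ∧ I ≤ y} I := by
  refine ⟨fun y hy => hy.2, fun L hL => ?_⟩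
  have hI := mem_divXSubgroup_iff.mp I.2
  obtain ⟨F, hF, hFI, h1, h2⟩ := hD.exists_isUnit_le hX (I : DivGroup D K).vInvertible.ne_zero hI.1
  change (I : DivGroup D K).ideal ≤ (L : DivGroup D K).ideal
  intro x hx
  have hu := hD.isUnit_sup_spanSingleton hF x
  have hle : F ⊔ FractionalIdeal.spanSingleton D⁰ x ≤ (I : DivGroup D K).ideal :=
    sup_le hFI (FractionalIdeal.spanSingleton_le_iff_mem.mpr hx)
  obtain ⟨M, hM⟩ := exists_invX_of_isUnit hu (h1.mono le_sup_left)
    (hI.2.mono (inv_anti hu.ne_zero hle))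
  have h3 : InvGroup.ideal (M : InvGroup D K) ≤ (L : DivGroup D K).ideal :=
    hL ⟨⟨M, rfl⟩, hM.le.trans hle⟩
  rw [hM] at h3
  exact FractionalIdeal.spanSingleton_le_iff_mem.mp (le_sup_right.trans h3)

theorem IsPruferDomain.isCompleteLGroup_divX (hD : IsPruferDomain D) (hX : IsCompact Xᶜ)
    (hmax : ∀ P ∈ X, P.asIdeal.IsMaximal) : IsCompleteLGroup (divXSubgroup K X) := by
  refine ⟨IsLGroup.of_exists_inf fun I J => ?_, hD.exists_isLUB_divX hmax⟩
  -- `Inv_X(D)` is directed and cofinal, so pairs are bounded, and completeness applies.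
  obtain ⟨g, hg⟩ := hD.exists_le_invXToDivX hX I⁻¹
  obtain ⟨h, hh⟩ := hD.exists_le_invXToDivX hX J⁻¹
  obtain ⟨k, hk⟩ := (hD.isLGroup_invX (K := K) (X := X)).exists_sup g h
  obtain ⟨c, hc⟩ := hD.exists_isLUB_divX hmax {I⁻¹, J⁻¹} ⟨I⁻¹, by simp⟩ ⟨invXToDivX K X k, by
    have h1 : invXToDivX K X g ≤ invXToDivX K X k := hk.1 (show g ∈ ({g, h} : Set _) by simp)
    have h2 : invXToDivX K X h ≤ invXToDivX K X k := hk.1 (show h ∈ ({g, h} : Set _) by simp)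
    rintro _ (rfl | rfl)
    · exact hg.trans h1
    · exact hh.trans h2⟩
  refine ⟨c⁻¹, ?_⟩
  simpa [Set.inv_insert] using hc.inv

end Ideals

end PruferDiv

theorem mainTheorem7 {D : Type u} [CommRing D] [IsDomain D]
    {K : Type v} [Field K] [Algebra D K] [IsFractionRing D K]
    (hD : PruferDiv.IsPruferDomain D)
    (X : Set (PrimeSpectrum D)) (hX : PruferDiv.IsSplittingSet X)
    (hmax : ∀ P ∈ X, P.asIdeal.IsMaximal) :
    PruferDiv.IsLGroup (PruferDiv.DivGroup D K) ∧
    ∃ S : Subgroup (PruferDiv.DivGroup D K),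
      (S : Set (PruferDiv.DivGroup D K)) = PruferDiv.divX K X ∧
      (S : Set (PruferDiv.DivGroup D K)).OrdConnected ∧
      PruferDiv.IsCompleteLGroup S ∧
      ∃ ι : PruferDiv.invX K X →* S,
        (∀ I : PruferDiv.invX K X,
          (ι I : PruferDiv.DivGroup D K).ideal =
            PruferDiv.InvGroup.ideal (I : PruferDiv.InvGroup D K)) ∧
        PruferDiv.IsLCompletion.{v, v, w} ι := by
  have hC := hD.isCompleteLGroup_divX (K := K) hX.2 hmax
  exact ⟨hD.isLGroup_divGroup, PruferDiv.divXSubgroup K X, rfl, PruferDiv.ordConnected_divX, hC,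
    PruferDiv.invXToDivX K X, PruferDiv.invXToDivX_ideal,
    PruferDiv.isLCompletion_of_isGLB_above hD.isLGroup_invX hC (fun _ _ => Iff.rfl)
      (hD.isGLB_invX_above hX.2) (hD.exists_le_invXToDivX hX.2)⟩
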